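/- Let $R$ be a principal ideal domain and $n \ge 0$ an integer. A collection of submodules of $R^n$ \emph{has a common basis} if there is a basis $B$ of $R^n$ such that each member of the collection is spanned by a subset of $B$. Let $T_n(R)$ be the simplicial complex whose vertices are the proper nonzero direct summands of $R^n$ and whose simplices are the nonempty finite flags, i.e. the nonempty finite sets of such summands totally ordered by inclusion. For $k \ge 0$ let $T^k_n(R)$ be the subcomplex of the $k$-fold join $T_n(R) * \cdots * T_n(R)$ consisting of the simplices $\sigma_1 * \cdots * \sigma_k$ (each $\sigma_i$ a possibly empty flag, not all empty) such that the collection $\bigcup_i \sigma_i$ has a common basis. Let $\iota\colon T^k_n(R) \to T^{k+1}_n(R)$ be the inclusion as the first $k$ join factors. Let $CB_n(R)$ be the common basis complex of Rognes: the simplicial complex whose vertices are the proper nonzero direct summands of $R^n$ and whose simplices are the nonempty finite sets of vertices that have a common basis. The simplicial maps $\pi_k\colon T^k_n(R) \to CB_n(R)$, $\sigma_1 * \cdots * \sigma_k \mapsto \bigcup_i \sigma_i$ (so that a vertex $V$ in any join factor goes to $V$), satisfy $\pi_{k+1} \circ \iota = \pi_k$. Then the induced continuous map of geometric realizations (with the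 weak topology) $$\pi\colon \operatorname{colim}_k |T^k_n(R)| \longrightarrow |CB_n(R)|$$ is a homotopy equivalence. -/

import Mathlib

open CategoryTheory CategoryTheory.Limits

universe u

noncomputable section

namespace CommonBasis

/-! ### Simplicial complexes, simplicial maps, geometric realization -/

/-- A simplicial map: a map of vertices that takes simplices to simplices. -/
structure SimplicialMap {V W : Type u} (K : AbstractSimplicialComplex V)
    (L : AbstractSimplicialComplex W) where
  toFun : V → W
  map_face : ∀ s ∈ K.faces, ∃ t ∈ L.faces, (t : Set W) = toFun '' (s : Set V)

/-- The points of the geometric realization `|K|`: the families of barycentric coordinates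
whose support is a simplex of `K`. -/
def Realization {V : Type u} (K : AbstractSimplicialComplex V) : Type u :=
  {x : V →₀ ℝ // (∀ v, 0 ≤ x v) ∧ (x.sum fun _ a => a) = 1 ∧ x.support ∈ K.faces}

/-- The inclusion of the closed simplex spanned by the face `s`. -/
def simplexMap {V : Type u} (K : AbstractSimplicialComplex V) (s : K.faces)
    (x : stdSimplex ℝ (s : Finset V)) : Realization K := by
  classical
  have hsum : (∑ v ∈ (s : Finset V).attach, Finsupp.single (v : V) (x.1 v)).sum
      (fun _ a => a) = 1 := by
    rw [← Finsupp.sum_finsetSum_index (h := fun _ a => a) (by simp) (by simp)]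
    simpa using x.2.2
  have hsub : (∑ v ∈ (s : Finset V).attach, Finsupp.single (v : V) (x.1 v)).support
      ⊆ (s : Finset V) := by
    intro v hv
    obtain ⟨w, -, hw⟩ := Finset.mem_biUnion.1 (Finsupp.support_finsetSum hv)
    have := Finsupp.support_single_subset hw
    rw [Finset.mem_singleton] at this
    exact this ▸ w.2
  refine ⟨∑ v ∈ (s : Finset V).attach, Finsupp.single (v : V) (x.1 v), fun v => ?_, hsum, ?_⟩
  · rw [Finsupp.finsetSum_apply]
    refine Finset.sum_nonneg fun w _ => ?_
    rw [Finsupp.single_apply]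
    split_ifs
    exacts [x.2.1 w, le_rfl]
  · refine (K.isRelLowerSet_faces s.2).2 hsub ?_
    rw [Finset.nonempty_iff_ne_empty]
    intro h
    rw [Finsupp.support_eq_empty.1 h] at hsum
    simp at hsum

/-- The weak topology: a set is open if and only if its preimage in every closed simplex is. -/
instance {V : Type u} (K : AbstractSimplicialComplex V) : TopologicalSpace (Realization K) :=
  ⨆ s : K.faces, TopologicalSpace.coinduced (simplexMap K s) inferInstance

theorem simplexMap_val {V : Type u} (K : AbstractSimplicialComplex V) (s : K.faces)
    (x : stdSimplex ℝ (s : Finset V)) :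
    (simplexMap K s x).1 = ∑ v ∈ (s : Finset V).attach, Finsupp.single (v : V) (x.1 v) := rfl

theorem continuous_simplexMap {V : Type u} (K : AbstractSimplicialComplex V) (s : K.faces) :
    Continuous (simplexMap K s) :=
  continuous_iff_coinduced_le.2 (le_iSup
    (fun s : K.faces => TopologicalSpace.coinduced (simplexMap K s) inferInstance) s)

/-- The map of points of the realizations induced by a simplicial map: it is affine on every
closed simplex and extends the map of vertices. -/
def realizationFun {V W : Type u} {K : AbstractSimplicialComplex V}
    {L : AbstractSimplicialComplex W} (f : SimplicialMap K L) (x : Realization K) :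
    Realization L := by
  classical
  have hsum : ((x.1.mapDomain f.toFun).sum fun _ a => a) = 1 := by
    rw [Finsupp.sum_mapDomain_index (by simp) (by simp)]
    exact x.2.2.1
  refine ⟨x.1.mapDomain f.toFun, fun w => ?_, hsum, ?_⟩
  · rw [Finsupp.mapDomain, Finsupp.sum, Finsupp.finsetSum_apply]
    refine Finset.sum_nonneg fun v _ => ?_
    rw [Finsupp.single_apply]
    split_ifs
    exacts [x.2.1 v, le_rfl]
  · obtain ⟨t, ht, hts⟩ := f.map_face _ x.2.2.2
    refine (L.isRelLowerSet_faces ht).2 (fun w hw => ?_) ?_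
    · have := Finsupp.mapDomain_support hw
      rw [← Finset.mem_coe, hts]
      simpa using this
    · rw [Finset.nonempty_iff_ne_empty]
      intro h
      rw [Finsupp.support_eq_empty.1 h] at hsum
      simp at hsum

theorem realizationFun_val {V W : Type u} {K : AbstractSimplicialComplex V}
    {L : AbstractSimplicialComplex W} (f : SimplicialMap K L) (x : Realization K) :
    (realizationFun f x).1 = x.1.mapDomain f.toFun := rfl

theorem continuous_realizationFun {V W : Type u} {K : AbstractSimplicialComplex V}
    {L : AbstractSimplicialComplex W} (f : SimplicialMap K L) :
    Continuous (realizationFun f) := by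
  classical
  refine continuous_iSup_dom.2 fun s => continuous_coinduced_dom.2 ?_
  obtain ⟨t, ht, hts⟩ := f.map_face _ s.2
  let g : ↥s.1 → ↥t := fun v =>
    ⟨f.toFun v.1, by rw [← Finset.mem_coe, hts]; exact ⟨v, v.2, rfl⟩⟩
  have key : realizationFun f ∘ simplexMap K s
      = simplexMap L ⟨t, ht⟩ ∘ stdSimplex.map g := by
    funext x
    refine Subtype.ext ?_
    simp only [Function.comp_apply, realizationFun_val, simplexMap_val]
    rw [Finsupp.mapDomain_finsetSum]
    simp only [Finsupp.mapDomain_single]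
    have h1 : ∀ w : t, (stdSimplex.map g x).1 w =
      ∑ v : ↥s.1 with g v = w, x.1 v := fun w => by
      have := stdSimplex.map_coe g x
      rw [show (stdSimplex.map g x).1 = ⇑(stdSimplex.map g x) from rfl, this]
      exact FunOnFinite.linearMap_apply_apply ℝ ℝ g _ w
    simp only [h1, ← Finset.univ_eq_attach]
    rw [← Finset.sum_fiberwise_of_maps_to (s := Finset.univ) (t := Finset.univ) (g := g)
      (fun _ _ => Finset.mem_univ _)]
    refine Finset.sum_congr rfl fun w _ => ?_
    rw [← Finsupp.singleAddHom_apply, map_sum]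
    refine Finset.sum_congr rfl fun v hv => ?_
    rw [Finsupp.singleAddHom_apply]
    rw [← (Finset.mem_filter.1 hv).2]
  rw [key]
  exact (continuous_simplexMap L ⟨t, ht⟩).comp (stdSimplex.continuous_map g)

/-- The continuous map `|f| : |K| → |L|` induced by a simplicial map `f`. -/
def realizationMap {V W : Type u} {K : AbstractSimplicialComplex V}
    {L : AbstractSimplicialComplex W} (f : SimplicialMap K L) :
    C(Realization K, Realization L) :=
  ⟨realizationFun f, continuous_realizationFun f⟩

/-- The order complex of a poset: its simplices are the nonempty finite chains. -/
def orderComplex (P : Type u) [PartialOrder P] : AbstractSimplicialComplex P where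
  faces := {s | s.Nonempty ∧ IsChain (· ≤ ·) (s : Set P)}
  isRelLowerSet_faces := fun _ hs =>
    ⟨hs.1, fun _ hts ht => ⟨ht, hs.2.mono (Finset.coe_subset.2 hts)⟩⟩
  singleton_mem v := ⟨Finset.singleton_nonempty v, by simp⟩

/-- The part of a finite set of vertices of a join that lies in the `i`-th join factor. -/
def joinPart {ι : Type} {V : ι → Type u} (s : Finset (Σ i, V i)) (i : ι) : Finset (V i) :=
  s.preimage (Sigma.mk i) sigma_mk_injective.injOn

/-- The join of a family of simplicial complexes: a simplex is a nonempty finite set of vertices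
whose part in each factor is empty or a simplex of that factor. -/
def join {ι : Type} {V : ι → Type u} (K : ∀ i, AbstractSimplicialComplex (V i)) :
    AbstractSimplicialComplex (Σ i, V i) where
  faces := {s | s.Nonempty ∧ ∀ i, (joinPart s i).Nonempty → joinPart s i ∈ (K i).faces}
  isRelLowerSet_faces := fun s hs => ⟨hs.1, fun t hts ht => ⟨ht, fun i hi => by
    have hsub : joinPart t i ⊆ joinPart s i := fun v hv => by
      simp only [joinPart, Finset.mem_preimage] at hv ⊢
      exact hts hv
    exact ((K i).isRelLowerSet_faces (hs.2 i (hi.mono hsub))).2 hsub hi⟩⟩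
  singleton_mem := by
    rintro ⟨j, v⟩
    refine ⟨Finset.singleton_nonempty _, fun i hi => ?_⟩
    obtain ⟨w, hw⟩ := hi
    simp only [joinPart, Finset.mem_preimage, Finset.mem_singleton] at hw
    obtain ⟨rfl, hw⟩ := Sigma.mk.inj_iff.1 hw
    convert (K i).singleton_mem v
    ext x
    simp [joinPart]

/-! ### Common bases, Tits buildings -/

/-- A collection of submodules of `R^n` has the common basis property if there is a basis of
`R^n` such that each of them is spanned by a subset of that basis. -/
def HasCommonBasis {R : Type u} [CommRing R] {n : ℕ}
    (σ : Set (Submodule R (Fin n → R))) : Prop :=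
  ∃ b : Module.Basis (Fin n) R (Fin n → R), ∀ U ∈ σ, ∃ S : Set (Fin n),
    U = Submodule.span R (b '' S)

/-- The poset (under inclusion) of proper nonzero summands of `R^n`. -/
abbrev Summand (R : Type u) [CommRing R] (n : ℕ) : Type u :=
  {U : Submodule R (Fin n → R) // U ≠ ⊥ ∧ U ≠ ⊤ ∧ ∃ C, IsCompl U C}

theorem HasCommonBasis.mono {R : Type u} [CommRing R] {n : ℕ}
    {σ τ : Set (Submodule R (Fin n → R))} (h : HasCommonBasis τ) (hs : σ ⊆ τ) :
    HasCommonBasis σ :=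
  let ⟨b, hb⟩ := h
  ⟨b, fun U hU => hb U (hs hU)⟩

theorem hasCommonBasis_singleton {R : Type u} [CommRing R] [IsDomain R]
    [IsPrincipalIdealRing R] {n : ℕ} (U : Submodule R (Fin n → R))
    (hU : ∃ C, IsCompl U C) : HasCommonBasis {U} := by
  obtain ⟨C, hC⟩ := hU
  obtain ⟨p, bU⟩ := Submodule.basisOfPid (Pi.basisFun R (Fin n)) U
  obtain ⟨q, bC⟩ := Submodule.basisOfPid (Pi.basisFun R (Fin n)) C
  let b := (bU.prod bC).map (Submodule.prodEquivOfIsCompl U C hC)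
  let e := b.indexEquiv (Pi.basisFun R (Fin n))
  refine ⟨b.reindex e, ?_⟩
  intro U' hU'
  rw [Set.mem_singleton_iff.1 hU']
  refine ⟨Set.range (e ∘ Sum.inl), ?_⟩
  rw [← Set.range_comp]
  have : (b.reindex e) ∘ (e ∘ Sum.inl) = U.subtype ∘ bU := by
    funext i
    simp [b]
  rw [this, Set.range_comp, Submodule.span_image, bU.span_eq, Submodule.map_top,
    Submodule.range_subtype]

/-- The Tits building `T_n(R)`: its simplices are the flags of proper nonzero summands. -/
def titsBuilding (R : Type u) [CommRing R] (n : ℕ) : AbstractSimplicialComplex (Summand R n) :=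
  orderComplex (Summand R n)

/-- Rognes' common basis complex `CB_n(R)`. -/
def commonBasisComplex (R : Type u) [CommRing R] [IsDomain R] [IsPrincipalIdealRing R] (n : ℕ) :
    AbstractSimplicialComplex (Summand R n) where
  faces := {s | s.Nonempty ∧ HasCommonBasis (Subtype.val '' (s : Set (Summand R n)))}
  isRelLowerSet_faces := fun _ hs =>
    ⟨hs.1, fun _ hts ht => ⟨ht, hs.2.mono (Set.image_mono (Finset.coe_subset.2 hts))⟩⟩
  singleton_mem V := by
    refine ⟨Finset.singleton_nonempty V, ?_⟩
    rw [Finset.coe_singleton, Set.image_singleton]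
    exact hasCommonBasis_singleton _ V.2.2.2

/-- The higher Tits building `T^k_n(R)`: the subcomplex of the `k`-fold join of `T_n(R)` of those
simplices (joins of `k` possibly empty flags) whose underlying summands have a common basis. -/
def higherBuilding (R : Type u) [CommRing R] [IsDomain R] [IsPrincipalIdealRing R] (n k : ℕ) :
    AbstractSimplicialComplex (Σ _ : Fin k, Summand R n) where
  faces := {s | s ∈ (join fun _ : Fin k => titsBuilding R n).faces ∧
    HasCommonBasis ((fun v : (Σ _ : Fin k, Summand R n) => v.2.1) '' (s : Set _))}
  isRelLowerSet_faces := fun _ hs =>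
    ⟨hs.1.1, fun _ hts ht => ⟨((join _).isRelLowerSet_faces hs.1).2 hts ht,
      hs.2.mono (Set.image_mono (Finset.coe_subset.2 hts))⟩⟩
  singleton_mem v := by
    refine ⟨(join _).singleton_mem v, ?_⟩
    rw [Finset.coe_singleton, Set.image_singleton]
    exact hasCommonBasis_singleton _ v.2.2.2.2

/-- The simplicial embedding `T^k_n(R) → T^j_n(R)` induced by an injection
`f : {1, …, k} → {1, …, j}` of join factors. -/
def levelMap (R : Type u) [CommRing R] [IsDomain R] [IsPrincipalIdealRing R] (n : ℕ) {k j : ℕ}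
    (f : Fin k ↪ Fin j) : SimplicialMap (higherBuilding R n k) (higherBuilding R n j) where
  toFun v := ⟨f v.1, v.2⟩
  map_face s hs := by
    classical
    refine ⟨s.image fun v => ⟨f v.1, v.2⟩, ⟨⟨hs.1.1.image _, fun i hi => ⟨hi, ?_⟩⟩, ?_⟩, by simp⟩
    · intro U hU W hW hne
      simp only [joinPart, Finset.coe_preimage, Set.mem_preimage, Finset.coe_image,
        Set.mem_image, Finset.mem_coe] at hU hW
      obtain ⟨⟨a, U'⟩, ha, hU⟩ := hU
      obtain ⟨⟨c, W'⟩, hc, hW⟩ := hW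
      simp only [Sigma.mk.inj_iff, heq_eq_eq] at hU hW
      obtain ⟨rfl, rfl⟩ := hU
      obtain ⟨hca, rfl⟩ := hW
      obtain rfl := f.injective hca
      have hU' : U' ∈ joinPart s c := by simpa [joinPart] using ha
      have hW' : W' ∈ joinPart s c := by simpa [joinPart] using hc
      exact (hs.1.2 c ⟨_, hU'⟩).2 hU' hW' hne
    · refine hs.2.mono ?_
      rw [Finset.coe_image, Set.image_image]

/-- The simplicial map `π : T^k_n(R) → CB_n(R)` that takes a vertex `V` of any join factor to `V`,
hence a join of flags to the union of these flags. -/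
def unionMap (R : Type u) [CommRing R] [IsDomain R] [IsPrincipalIdealRing R] (n k : ℕ) :
    SimplicialMap (higherBuilding R n k) (commonBasisComplex R n) where
  toFun v := v.2
  map_face s hs := by
    classical
    refine ⟨s.image fun v => v.2, ⟨hs.1.1.image _, hs.2.mono ?_⟩, by simp⟩
    rw [Finset.coe_image, Set.image_image]

/-- The sequence of spaces `|T^0_n(R)| → |T^1_n(R)| → |T^2_n(R)| → ⋯`, with the maps induced by
the standard inclusions `{1, …, k} ⊆ {1, …, j}` for `k ≤ j`. -/
def buildingTower (R : Type u) [CommRing R] [IsDomain R] [IsPrincipalIdealRing R] (n : ℕ) :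
    ℕ ⥤ TopCat.{u} where
  obj k := TopCat.of (Realization (higherBuilding R n k))
  map {_ _} h := TopCat.ofHom (realizationMap (levelMap R n (Fin.castLEEmb (leOfHom h))))
  map_id k := by
    ext x
    exact Subtype.ext Finsupp.mapDomain_id
  map_comp f g := by
    ext x
    exact Subtype.ext (Finsupp.mapDomain_comp (v := x.1)
      (f := (levelMap R n (Fin.castLEEmb (leOfHom f))).toFun)
      (g := (levelMap R n (Fin.castLEEmb (leOfHom g))).toFun))

/-- The maps `|π| : |T^k_n(R)| → |CB_n(R)|`, which are compatible for varying `k`. -/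
def unionCocone (R : Type u) [CommRing R] [IsDomain R] [IsPrincipalIdealRing R] (n : ℕ) :
    Cocone (buildingTower R n) where
  pt := TopCat.of (Realization (commonBasisComplex R n))
  ι :=
    { app := fun k => TopCat.ofHom (realizationMap (unionMap R n k))
      naturality := fun _ _ _ => by
        ext x
        exact Subtype.ext (Finsupp.mapDomain_comp (v := x.1)).symm }

/-- The map `π : colim_k |T^k_n(R)| → |CB_n(R)|` induced on the colimit. -/
def colimUnionMap (R : Type u) [CommRing R] [IsDomain R] [IsPrincipalIdealRing R] (n : ℕ) :
    colimit (buildingTower R n) ⟶ TopCat.of (Realization (commonBasisComplex R n)) :=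
  colimit.desc (buildingTower R n) (unionCocone R n)

/-- A continuous map is a homotopy equivalence if it has a homotopy inverse. -/
def IsHomotopyEquivalence {X Y : Type u} [TopologicalSpace X] [TopologicalSpace Y]
    (f : C(X, Y)) : Prop :=
  ∃ g : C(Y, X), (g.comp f).Homotopic (ContinuousMap.id X) ∧
    (f.comp g).Homotopic (ContinuousMap.id Y)

end CommonBasis

end

noncomputable section

namespace CommonBasis

/-! ### Points of the realization and continuity in terms of coordinates -/

section Realization

variable {V W : Type u} {K : AbstractSimplicialComplex V} {L : AbstractSimplicialComplex W}

/-! The colimit is the realization of one complex, `stableBuilding`: its vertices are summands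
labelled by a level in `ℕ`, and its simplices lie over simplices of `CB_n(R)` and form a flag on
each level (`exists_stableToColimit`). It remains to see that forgetting levels is a homotopy
equivalence. This holds over any complex `C` on a preordered set
(`isHomotopyEquivalence_levelProj`); algebra enters only through `mem_higherBuilding_faces_iff`.

With unlimited levels the flag condition can be made void by putting distinct vertices on distinct
levels. To do this continuously, without ordering the vertices globally, `exists_section` imitates
barycentric subdivision: the sets `σ` of vertices whose coordinates dominate all others form a
chain, so they are separated by cardinality, and a chosen vertex of `σ` is put on level `2 * σ.card
+ 1`. This map `g` has image over the same closed simplex, so projection after `g` is homotopic to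
the identity by straight lines.

For the other composite, `homotopic_double` moves level `i` to level `2 * i`. The doubled identity
uses even levels only and `g` odd levels only, so the two never interfere and a straight-line
homotopy joins them (`homotopic_of_contiguous`). -/

theorem Realization.nonneg (x : Realization K) (v : V) : 0 ≤ x.1 v := x.2.1 v

theorem Realization.support_mem (x : Realization K) : x.1.support ∈ K.faces := x.2.2.2

theorem Realization.sum_eq_one (x : Realization K) {S : Finset V} (hS : x.1.support ⊆ S) :
    ∑ v ∈ S, x.1 v = 1 := by
  exact (Finsupp.sum_of_support_subset x.1 hS (fun _ a => a) (by simp)).symm.trans x.2.2.1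

/-- A convex combination of vertices of a face is a point of the realization. -/
def Realization.ofFace {t : Finset V} (ht : t ∈ K.faces) (x : V →₀ ℝ) (h0 : ∀ v, 0 ≤ x v)
    (h1 : (x.sum fun _ a => a) = 1) (hs : x.support ⊆ t) : Realization K :=
  ⟨x, h0, h1, (K.isRelLowerSet_faces ht).2 hs (by
    rw [Finset.nonempty_iff_ne_empty]
    intro h
    rw [Finsupp.support_eq_empty.1 h] at h1
    simp at h1)⟩

theorem simplexMap_apply (s : K.faces) (y : stdSimplex ℝ (s : Finset V)) (v : V) [Decidable (v ∈ s.1)] :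
    (simplexMap K s y).1 v = if h : v ∈ s.1 then y.1 ⟨v, h⟩ else 0 := by
  classical
  rw [simplexMap_val, Finsupp.finsetSum_apply]
  simp only [Finsupp.single_apply]
  split_ifs with h
  · rw [Finset.sum_eq_single (⟨v, h⟩ : s.1)]
    · simp
    · intro b _ hb
      rw [if_neg]
      exact fun hbv => hb (Subtype.ext hbv)
    · intro hv
      exact absurd (Finset.mem_attach _ _) hv
  · refine Finset.sum_eq_zero fun w _ => if_neg ?_
    rintro rfl
    exact h w.2

theorem continuous_simplexMap_apply (s : K.faces) (v : V) :
    Continuous fun y => (simplexMap K s y).1 v := by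
  classical
  simp only [simplexMap_apply]
  split_ifs with h
  · exact (continuous_apply _).comp continuous_subtype_val
  · exact continuous_const

theorem support_simplexMap_subset (s : K.faces) (y : stdSimplex ℝ (s : Finset V)) :
    (simplexMap K s y).1.support ⊆ s.1 := by
  classical
  intro v hv
  by_contra h
  rw [Finsupp.mem_support_iff, simplexMap_apply, dif_neg h] at hv
  exact hv rfl

theorem exists_simplexMap_eq (s : K.faces) (x : Realization K) (hx : x.1.support ⊆ s.1) :
    ∃ y, simplexMap K s y = x := by
  classical
  refine ⟨⟨fun v => x.1 v, fun v => x.nonneg v, ?_⟩, Subtype.ext (Finsupp.ext fun v => ?_)⟩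
  · exact (Finset.sum_coe_sort s.1 fun v => x.1 v).trans (x.sum_eq_one hx)
  · rw [simplexMap_apply]
    split_ifs with h
    · rfl
    · exact (Finsupp.notMem_support_iff.1 fun hv => h (hx hv)).symm

theorem continuous_realization_iff {Z : Type*} [TopologicalSpace Z] {f : Realization K → Z} :
    Continuous f ↔ ∀ s : K.faces, Continuous (f ∘ simplexMap K s) :=
  continuous_iSup_dom.trans (forall_congr' fun _ => continuous_coinduced_dom)

theorem continuous_coord (v : V) : Continuous fun x : Realization K => x.1 v :=
  continuous_realization_iff.2 fun s => continuous_simplexMap_apply s v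

/-- A map into a realization is continuous as soon as it involves only finitely many vertices and
has continuous coordinates. -/
theorem continuous_of_coord {X : Type*} [TopologicalSpace X] {h : X → Realization L}
    (A : Finset W) (hA : ∀ x, (h x).1.support ⊆ A) (hc : ∀ w, Continuous fun x => (h x).1 w) :
    Continuous h := by
  classical
  rw [continuous_iff_isClosed]
  intro C hC
  -- The weak topology may be finer than that of coordinates, but closed simplices are compact, so a
  -- closed part of one has closed image in `W → ℝ`. Only finitely many faces lie in `A`, so `h ⁻¹'
  -- C` is a finite union of closed sets.
  let coord : Realization L → W → ℝ := fun x w => x.1 w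
  have hcoord : Continuous coord := continuous_pi continuous_coord
  have hinj : Function.Injective coord := fun x y hxy =>
    Subtype.ext (Finsupp.ext fun w => congrFun hxy w)
  have hK : ∀ t : L.faces, IsClosed (coord '' (simplexMap L t '' (simplexMap L t ⁻¹' C))) :=
    fun t => (((hC.preimage (continuous_simplexMap L t)).isCompact.image
      (continuous_simplexMap L t)).image hcoord).isClosed
  have hfin : {t : L.faces | t.1 ⊆ A}.Finite := by
    refine Set.Finite.of_finite_image (f := Subtype.val) (A.powerset.finite_toSet.subset ?_)
      Subtype.val_injective.injOn
    rintro _ ⟨t, ht, rfl⟩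
    simpa using ht
  have hpre : h ⁻¹' C = ⋃ t ∈ {t : L.faces | t.1 ⊆ A},
      (coord ∘ h) ⁻¹' (coord '' (simplexMap L t '' (simplexMap L t ⁻¹' C))) := by
    ext x
    simp only [Set.mem_preimage, Set.mem_iUnion, Set.mem_ofPred_eq, Function.comp_apply,
      hinj.mem_set_image, exists_prop]
    constructor
    · intro hx
      obtain ⟨y, hy⟩ := exists_simplexMap_eq ⟨_, (h x).support_mem⟩ (h x) subset_rfl
      exact ⟨⟨_, (h x).support_mem⟩, hA x, y, by rwa [Set.mem_preimage, hy], hy⟩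
    · rintro ⟨t, -, y, hy, hyx⟩
      rwa [← hyx]
  rw [hpre]
  exact hfin.isClosed_biUnion fun t _ => (hK t).preimage (continuous_pi hc)

/-- Continuity on `|K| × I` can be checked on the closed simplices. -/
theorem continuous_realization_prod {Z : Type*} [TopologicalSpace Z]
    {F : Realization K × unitInterval → Z}
    (hF : ∀ s : K.faces,
      Continuous fun p : stdSimplex ℝ (s : Finset V) × unitInterval =>
        F (simplexMap K s p.1, p.2)) : Continuous F := by
  have hx : ∀ x : Realization K, Continuous fun t => F (x, t) := fun x => by
    obtain ⟨y, hy⟩ := exists_simplexMap_eq ⟨_, x.support_mem⟩ x subset_rfl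
    have := (hF ⟨_, x.support_mem⟩).comp (Continuous.prodMk_right y)
    simpa only [Function.comp_def, hy] using this
  -- Currying turns the question into one on `|K|` alone, where simplices detect continuity;
  -- uncurrying is allowed because the interval is locally compact.
  let G : Realization K → C(unitInterval, Z) := fun x => ⟨fun t => F (x, t), hx x⟩
  have hG : Continuous G := continuous_realization_iff.2 fun s =>
    ContinuousMap.continuous_of_continuous_uncurry _ (hF s)
  exact ContinuousMap.continuous_uncurry_of_continuous ⟨G, hG⟩

/-! ### Finitely carried maps and straight-line homotopies -/

/-- A map of realizations is finitely carried if points with coordinates in a given finite set of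
vertices have images with coordinates in some finite set of vertices. -/
def FinitelyCarried (f : Realization K → Realization L) : Prop :=
  ∀ S : Finset V, ∃ A : Finset W, ∀ x : Realization K, x.1.support ⊆ S → (f x).1.support ⊆ A

theorem FinitelyCarried.id : FinitelyCarried (fun x : Realization K => x) :=
  fun S => ⟨S, fun _ h => h⟩

theorem FinitelyCarried.comp {U : Type u} {M : AbstractSimplicialComplex U}
    {g : Realization L → Realization M} {f : Realization K → Realization L}
    (hg : FinitelyCarried g) (hf : FinitelyCarried f) : FinitelyCarried (g ∘ f) := fun S =>
  let ⟨A, hA⟩ := hf S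
  let ⟨B, hB⟩ := hg A
  ⟨B, fun x hx => hB _ (hA x hx)⟩

theorem support_realizationFun_subset [DecidableEq W] (f : SimplicialMap K L) (x : Realization K) :
    (realizationFun f x).1.support ⊆ x.1.support.image f.toFun := by
  rw [realizationFun_val]
  convert Finsupp.mapDomain_support

theorem finitelyCarried_realizationFun (f : SimplicialMap K L) :
    FinitelyCarried (realizationFun f) := by
  classical
  exact fun S => ⟨S.image f.toFun, fun x hx =>
    (support_realizationFun_subset f x).trans (Finset.image_subset_image hx)⟩

theorem FinitelyCarried.continuous_of_coord {f : Realization K → Realization L}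
    (hf : FinitelyCarried f)
    (hc : ∀ (s : K.faces) (w : W), Continuous fun y => (f (simplexMap K s y)).1 w) :
    Continuous f :=
  continuous_realization_iff.2 fun s =>
    let ⟨A, hA⟩ := hf s.1
    CommonBasis.continuous_of_coord A (fun y => hA _ (support_simplexMap_subset s y)) (hc s)

/-- A family of maps of realizations is a homotopy if it is finitely carried and has continuous
coordinates on every closed simplex. -/
theorem continuous_homotopy_of_coord {F : Realization K × unitInterval → Realization L}
    (hA : ∀ S : Finset V, ∃ A : Finset W, ∀ (x : Realization K) (t : unitInterval),
      x.1.support ⊆ S → (F (x, t)).1.support ⊆ A)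
    (hc : ∀ (s : K.faces) (w : W),
      Continuous fun p : stdSimplex ℝ (s : Finset V) × unitInterval =>
        (F (simplexMap K s p.1, p.2)).1 w) : Continuous F :=
  continuous_realization_prod fun s =>
    let ⟨A, hA⟩ := hA s.1
    continuous_of_coord A (fun p => hA _ _ (support_simplexMap_subset s p.1)) (hc s)

theorem homotopic_of_continuous {X Y : Type*} [TopologicalSpace X] [TopologicalSpace Y]
    {f g : C(X, Y)} {F : X × unitInterval → Y} (hF : Continuous F) (h0 : ∀ x, F (x, 0) = f x)
    (h1 : ∀ x, F (x, 1) = g x) : f.Homotopic g :=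
  ⟨⟨⟨fun p => F (p.2, p.1), hF.comp continuous_swap⟩, h0, h1⟩⟩

/-- Two maps that take every point into a common closed simplex are homotopic, by a straight-line
homotopy. -/
theorem homotopic_of_contiguous (f g : C(Realization K, Realization L))
    (hf : FinitelyCarried f) (hg : FinitelyCarried g)
    (h : ∀ x, ∃ t ∈ L.faces, (f x).1.support ⊆ t ∧ (g x).1.support ⊆ t) : f.Homotopic g := by
  classical
  choose T hT hfT hgT using h
  have hsum : ∀ y : Realization L, ∀ c : ℝ, ((c • y.1).sum fun _ a => a) = c := fun y c => by
    rw [Finsupp.sum_smul_index (by simp), ← Finsupp.mul_sum, y.2.2.1, mul_one]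
  have hsupp : ∀ (x : Realization K) (a b : ℝ),
      (a • (f x).1 + b • (g x).1).support ⊆ (f x).1.support ∪ (g x).1.support :=
    fun x a b => Finsupp.support_add.trans
      (Finset.union_subset_union Finsupp.support_smul Finsupp.support_smul)
  let F : Realization K × unitInterval → Realization L := fun p =>
    Realization.ofFace (hT p.1) ((1 - p.2 : ℝ) • (f p.1).1 + (p.2 : ℝ) • (g p.1).1)
      (fun v => by
        have h1 := (f p.1).nonneg v
        have h2 := (g p.1).nonneg v
        have h3 := p.2.2.1
        have h4 := sub_nonneg.2 p.2.2.2
        simp only [Finsupp.add_apply, Finsupp.smul_apply, smul_eq_mul]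
        positivity)
      (by
        rw [Finsupp.sum_add_index' (by simp) (by simp), hsum, hsum]
        ring)
      ((hsupp _ _ _).trans (Finset.union_subset (hfT _) (hgT _)))
  have hF : Continuous F := by
    refine continuous_homotopy_of_coord (fun S => ?_) fun s w => ?_
    · obtain ⟨A, hA⟩ := hf S
      obtain ⟨B, hB⟩ := hg S
      exact ⟨A ∪ B, fun x t hx =>
        (hsupp x _ _).trans (Finset.union_subset_union (hA x hx) (hB x hx))⟩
    · have e : ∀ p : stdSimplex ℝ (s : Finset V) × unitInterval,
          (F (simplexMap K s p.1, p.2)).1 w = (1 - p.2 : ℝ) * (f (simplexMap K s p.1)).1 w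
            + (p.2 : ℝ) * (g (simplexMap K s p.1)).1 w := fun p => rfl
      simp only [e]
      have hcf : Continuous fun p : stdSimplex ℝ (s : Finset V) × unitInterval =>
          (f (simplexMap K s p.1)).1 w :=
        (continuous_coord w).comp (f.continuous.comp ((continuous_simplexMap K s).comp continuous_fst))
      have hcg : Continuous fun p : stdSimplex ℝ (s : Finset V) × unitInterval =>
          (g (simplexMap K s p.1)).1 w :=
        (continuous_coord w).comp (g.continuous.comp ((continuous_simplexMap K s).comp continuous_fst))
      fun_prop
  exact homotopic_of_continuous hF (fun x => Subtype.ext (by simp [F, Realization.ofFace]))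
    fun x => Subtype.ext (by simp [F, Realization.ofFace])

end Realization

/-! ### Sums of point masses -/

theorem sum_sum_single {α β : Type*} (S : Finset α) (a : α → β) (b : α → ℝ) :
    ((∑ i ∈ S, Finsupp.single (a i) (b i)).sum fun _ c => c) = ∑ i ∈ S, b i := by
  rw [← Finsupp.sum_finsetSum_index (h := fun _ c => c) (by simp) (by simp)]
  simp

theorem mem_support_sum_single {α β : Type*} {S : Finset α} {a : α → β} {b : α → ℝ} {w : β}
    (hw : w ∈ (∑ i ∈ S, Finsupp.single (a i) (b i)).support) : ∃ i ∈ S, b i ≠ 0 ∧ w = a i := by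
  classical
  obtain ⟨i, hi, hiw⟩ := Finset.mem_biUnion.1 (Finsupp.support_finsetSum hw)
  rw [Finsupp.mem_support_iff, Finsupp.single_apply] at hiw
  split_ifs at hiw with h
  · exact ⟨i, hi, hiw, h.symm⟩
  · exact absurd rfl hiw

theorem sum_single_nonneg {α β : Type*} {S : Finset α} {a : α → β} {b : α → ℝ}
    (hb : ∀ i ∈ S, 0 ≤ b i) (w : β) : 0 ≤ (∑ i ∈ S, Finsupp.single (a i) (b i)) w := by
  classical
  rw [Finsupp.finsetSum_apply]
  refine Finset.sum_nonneg fun i hi => ?_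
  rw [Finsupp.single_apply]
  split_ifs
  exacts [hb i hi, le_rfl]

theorem continuous_sum_single_apply {X α β : Type*} [TopologicalSpace X] (S : Finset α) (a : α → β)
    {b : α → X → ℝ} (hb : ∀ i, Continuous (b i)) (w : β) :
    Continuous fun x => (∑ i ∈ S, Finsupp.single (a i) (b i x)) w := by
  classical
  simp only [Finsupp.finsetSum_apply, Finsupp.single_apply]
  refine continuous_finsetSum _ fun i _ => ?_
  split_ifs
  exacts [hb i, continuous_const]

/-! ### Weights of sets of vertices -/

section Weights

variable {V : Type u}

/-- A function of barycentric coordinates that is positive if and only if `σ` consists of vertices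
with positive coordinates larger than all other coordinates. -/
def weight (S : Finset V) (x : V →₀ ℝ) (σ : Finset V) : NNReal := by
  classical
  -- Subtraction in `NNReal` is truncated, so a factor vanishes unless `x v` exceeds every
  -- coordinate in `S \ σ`; the supremum over the empty set is `0`. The empty `σ` has weight `1` and
  -- is excluded later by `nonemptySubsets`.
  exact ∏ v ∈ σ, ((x v).toNNReal - (S \ σ).sup fun w => (x w).toNNReal)

/-- Extra vertices have coordinate `0` and do not affect the supremum. Hence one formula, with `S` a
face, serves on a whole closed simplex although supports jump. -/
theorem weight_eq_weight_support {S : Finset V} {x : V →₀ ℝ} (h : x.support ⊆ S) (σ : Finset V) :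
    weight S x σ = weight x.support x σ := by
  classical
  simp only [weight]
  refine Finset.prod_congr rfl fun v _ => congrArg _ (le_antisymm
    (Finset.sup_le fun w hw => ?_) (Finset.sup_mono (Finset.sdiff_subset_sdiff h subset_rfl)))
  by_cases hx : w ∈ x.support
  · exact Finset.le_sup (f := fun w => (x w).toNNReal)
      (Finset.mem_sdiff.2 ⟨hx, (Finset.mem_sdiff.1 hw).2⟩)
  · simp [Finsupp.notMem_support_iff.1 hx]

theorem lt_of_weight_ne_zero {x : V →₀ ℝ} {σ : Finset V} (h : weight x.support x σ ≠ 0) {v w : V}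
    (hv : v ∈ σ) (hw : w ∉ σ) : (x w).toNNReal < (x v).toNNReal := by
  classical
  have h1 := Finset.prod_ne_zero_iff.1 h v hv
  have h2 := tsub_pos_iff_lt.1 (pos_iff_ne_zero.2 h1)
  by_cases hx : w ∈ x.support
  · exact (Finset.le_sup (f := fun w => (x w).toNNReal)
      (Finset.mem_sdiff.2 ⟨hx, hw⟩)).trans_lt h2
  · rw [Finsupp.notMem_support_iff.1 hx, Real.toNNReal_zero]
    exact (zero_le).trans_lt h2

theorem subset_support_of_weight_ne_zero {x : V →₀ ℝ} {σ : Finset V}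
    (h : weight x.support x σ ≠ 0) : σ ⊆ x.support := by
  classical
  intro v hv
  have h2 := tsub_pos_iff_lt.1 (pos_iff_ne_zero.2 (Finset.prod_ne_zero_iff.1 h v hv))
  rw [Finsupp.mem_support_iff]
  intro h0
  rw [h0, Real.toNNReal_zero] at h2
  exact not_lt_zero h2

/-- If neither set contained the other, a vertex of `σ` outside `τ` and one of `τ` outside `σ` would
each have the larger coordinate. So cardinality can serve as a level. -/
theorem eq_of_weight_ne_zero {x : V →₀ ℝ} {σ τ : Finset V} (hσ : weight x.support x σ ≠ 0)
    (hτ : weight x.support x τ ≠ 0) (h : σ.card = τ.card) : σ = τ := by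
  by_cases h1 : σ ⊆ τ
  · exact Finset.eq_of_subset_of_card_le h1 h.ge
  by_cases h2 : τ ⊆ σ
  · exact (Finset.eq_of_subset_of_card_le h2 h.le).symm
  obtain ⟨v, hv, hv'⟩ := Finset.not_subset.1 h1
  obtain ⟨w, hw, hw'⟩ := Finset.not_subset.1 h2
  exact absurd (lt_of_weight_ne_zero hσ hv hw') (lt_of_weight_ne_zero hτ hw hv').asymm

/-- Nothing is subtracted here, so the factors are the positive coordinates. This keeps the total
weight nonzero for normalization. -/
theorem weight_support_pos {x : V →₀ ℝ} (h : ∀ v, 0 ≤ x v) : 0 < weight x.support x x.support := by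
  classical
  refine Finset.prod_pos fun v hv => ?_
  rw [sdiff_self, Finset.bot_eq_empty, Finset.sup_empty, bot_eq_zero', tsub_zero, Real.toNNReal_pos]
  exact (h v).lt_of_ne (Finsupp.mem_support_iff.1 hv).symm

theorem continuous_weight {X : Type*} [TopologicalSpace X] {f : X → V →₀ ℝ}
    (hf : ∀ v, Continuous fun x => f x v) (S σ : Finset V) :
    Continuous fun x => weight S (f x) σ := by
  classical
  simp only [weight]
  have h : ∀ v, Continuous fun x => (f x v).toNNReal := fun v => continuous_real_toNNReal.comp (hf v)
  exact continuous_finsetProd _ fun v _ =>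
    (h v).sub (Continuous.finset_sup_apply fun w _ => h w)

/-- The nonempty subsets of a finite set. -/
def nonemptySubsets (S : Finset V) : Finset (Finset V) := {σ ∈ S.powerset | σ.Nonempty}

end Weights

theorem image_snd_mem_faces {V : Type u} [DecidableEq V] {C : AbstractSimplicialComplex V} {ι : Type}
    {s : Finset (Σ _ : ι, V)} (hs : s.Nonempty)
    {t : Finset V} (ht : t ∈ C.faces) (h : ∀ v ∈ s, v.2 ∈ t) :
    s.image (fun v => v.2) ∈ C.faces :=
  (C.isRelLowerSet_faces ht).2 (Finset.image_subset_iff.2 h) (hs.image _)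

/-! ### Complexes of levels -/

section Levels

variable {V : Type u} [Preorder V] (C : AbstractSimplicialComplex V) (ι : Type)

/-- The subcomplex of the join of `ι` copies of the order complex of `V` consisting of the simplices
that lie over a simplex of `C`. -/
def levelComplex : AbstractSimplicialComplex (Σ _ : ι, V) where
  faces := {s | s.Nonempty ∧ (∀ v ∈ s, ∀ w ∈ s, v.1 = w.1 → v.2 ≤ w.2 ∨ w.2 ≤ v.2) ∧
    ∃ t ∈ C.faces, ∀ v ∈ s, v.2 ∈ t}
  isRelLowerSet_faces := fun _ hs => ⟨hs.1, fun _ hts ht =>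
    ⟨ht, fun v hv w hw => hs.2.1 v (hts hv) w (hts hw),
      hs.2.2.imp fun _ h => ⟨h.1, fun v hv => h.2 v (hts hv)⟩⟩⟩
  singleton_mem v := by
    refine ⟨Finset.singleton_nonempty v, ?_, {v.2}, C.singleton_mem _, by simp⟩
    simp only [Finset.mem_singleton]
    rintro _ rfl _ rfl -
    exact Or.inl le_rfl

variable {C ι}

/-- The projection of a complex of levels. -/
def levelProj (C : AbstractSimplicialComplex V) (ι : Type) : SimplicialMap (levelComplex C ι) C where
  toFun v := v.2
  map_face s hs := by
    classical
    obtain ⟨hne, -, t, ht, h⟩ := hs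
    exact ⟨_, image_snd_mem_faces hne ht h, by simp⟩

/-- The map of complexes of levels induced by an injection of the sets of levels. -/
def levelReindex (C : AbstractSimplicialComplex V) {ι κ : Type} (f : ι ↪ κ) :
    SimplicialMap (levelComplex C ι) (levelComplex C κ) where
  toFun v := ⟨f v.1, v.2⟩
  map_face s hs := by
    classical
    obtain ⟨hne, hch, t, ht, h⟩ := hs
    refine ⟨s.image fun v => ⟨f v.1, v.2⟩, ⟨hne.image _, ?_, t, ht, ?_⟩, by simp⟩
    · simp only [Finset.mem_image]
      rintro _ ⟨v, hv, rfl⟩ _ ⟨w, hw, rfl⟩ hvw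
      exact hch v hv w hw (f.injective hvw)
    · simp only [Finset.mem_image]
      rintro _ ⟨v, hv, rfl⟩
      exact h v hv

/-- A point of the realization of a complex of levels, from its barycentric coordinates. -/
def levelPoint (x : (Σ _ : ι, V) →₀ ℝ) (h0 : ∀ v, 0 ≤ x v) (h1 : (x.sum fun _ a => a) = 1)
    (h2 : ∀ v ∈ x.support, ∀ w ∈ x.support, v.1 = w.1 → v.2 ≤ w.2 ∨ w.2 ≤ v.2)
    {t : Finset V} (ht : t ∈ C.faces) (h3 : ∀ v ∈ x.support, v.2 ∈ t) :
    Realization (levelComplex C ι) :=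
  ⟨x, h0, h1, by
    refine ⟨?_, h2, t, ht, h3⟩
    rw [Finset.nonempty_iff_ne_empty]
    intro h
    rw [Finsupp.support_eq_empty.1 h] at h1
    simp at h1⟩

/-! ### Spreading the levels apart -/

/-- The part of level `i` that has moved to level `2 * i` at time `t`. The higher levels move
first. -/
def moved (i : ℕ) (t : ℝ) : ℝ := max 0 (min 1 ((i + 1) * (i + 2) * t - (i + 1)))

theorem moved_nonneg (i : ℕ) (t : ℝ) : 0 ≤ moved i t := le_max_left _ _

theorem moved_le_one (i : ℕ) (t : ℝ) : moved i t ≤ 1 := max_le zero_le_one (min_le_left _ _)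

theorem continuous_moved (i : ℕ) : Continuous (moved i) := by
  unfold moved
  fun_prop

theorem moved_zero (i : ℕ) : moved i 0 = 0 := by
  refine max_eq_left ((min_le_right _ _).trans ?_)
  have : (0 : ℝ) ≤ i := i.cast_nonneg
  linarith

theorem moved_one (i : ℕ) : moved i 1 = 1 := by
  have : (0 : ℝ) ≤ i := i.cast_nonneg
  rw [moved, min_eq_left (by nlinarith), max_eq_right zero_le_one]

/-- Level `i` moves during the interval from `1 / (i + 2)` to `1 / (i + 1)`. These intervals meet
only in endpoints, and that of a higher level comes earlier. -/
theorem moved_eq_one_of_pos {i j : ℕ} (hji : j < i) {t : ℝ} (h : 0 < moved j t) :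
    moved i t = 1 := by
  have hj : (0 : ℝ) ≤ j := j.cast_nonneg
  have hi : (j : ℝ) + 1 ≤ i := by exact_mod_cast hji
  have h1 : 0 < ((j : ℝ) + 1) * (j + 2) * t - (j + 1) := by
    by_contra hcon
    rw [moved, max_eq_left ((min_le_right _ _).trans (not_lt.1 hcon))] at h
    exact lt_irrefl _ h
  have h2 : 1 < ((j : ℝ) + 2) * t := by
    by_contra hcon
    nlinarith
  have h3 : 1 ≤ ((i : ℝ) + 1) * t := by
    have : 0 < t := by
      by_contra hcon
      nlinarith
    nlinarith
  rw [moved, min_eq_left (by nlinarith), max_eq_right zero_le_one]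

/-- The injection `i ↦ 2 * i` of the levels. -/
def doubleEmb : ℕ ↪ ℕ := ⟨fun i => 2 * i, fun _ _ h => by simpa using h⟩

theorem homotopic_double (C : AbstractSimplicialComplex V) :
    (ContinuousMap.id _).Homotopic (realizationMap (levelReindex C doubleEmb)) := by
  classical
  let d : (Σ _ : ℕ, V) → (Σ _ : ℕ, V) := fun v => ⟨2 * v.1, v.2⟩
  -- The map uses `S = x.support`; taking `S` to be a face gives a formula whose continuity on that
  -- closed simplex is visible.
  let raw : Finset (Σ _ : ℕ, V) → ((Σ _ : ℕ, V) →₀ ℝ) → ℝ → (Σ _ : ℕ, V) →₀ ℝ := fun S x t =>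
    (∑ v ∈ S, Finsupp.single v ((1 - moved v.1 t) * x v)) +
      ∑ v ∈ S, Finsupp.single (d v) (moved v.1 t * x v)
  have hraw : ∀ S x t, x.support ⊆ S → raw S x t = raw x.support x t := fun S x t h => by
    simp only [raw]
    congr 1 <;>
    · refine (Finset.sum_subset h fun v _ hv => ?_).symm
      rw [Finsupp.notMem_support_iff.1 hv, mul_zero, Finsupp.single_zero]
  have hsupp : ∀ x t w, w ∈ (raw x.support x t).support →
      (w ∈ x.support ∧ moved w.1 t ≠ 1) ∨ ∃ v ∈ x.support, 0 < moved v.1 t ∧ w = d v := by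
    intro x t w hw
    rcases Finset.mem_union.1 (Finsupp.support_add hw) with h | h
    · obtain ⟨v, hv, hne, rfl⟩ := mem_support_sum_single h
      exact Or.inl ⟨hv, fun h1 => hne (by rw [h1, sub_self, zero_mul])⟩
    · obtain ⟨v, hv, hne, rfl⟩ := mem_support_sum_single h
      exact Or.inr ⟨v, hv, (moved_nonneg _ _).lt_of_ne (left_ne_zero_of_mul hne).symm, rfl⟩
  have hex : ∀ p : Realization (levelComplex C ℕ) × unitInterval,
      ∃ y : Realization (levelComplex C ℕ), y.1 = raw p.1.1.support p.1.1 p.2 := by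
    rintro ⟨x, t⟩
    obtain ⟨-, hch, T, hT, hxT⟩ := x.support_mem
    refine ⟨levelPoint _ (fun w => add_nonneg ?_ ?_) ?_ ?_ hT ?_, rfl⟩
    · exact sum_single_nonneg (fun v _ => mul_nonneg (sub_nonneg.2 (moved_le_one _ _)) (x.nonneg v)) w
    · exact sum_single_nonneg (fun v _ => mul_nonneg (moved_nonneg _ _) (x.nonneg v)) w
    · rw [Finsupp.sum_add_index' (by simp) (by simp), sum_sum_single, sum_sum_single,
        ← Finset.sum_add_distrib]
      exact (Finset.sum_congr rfl fun v _ => by ring).trans (x.sum_eq_one subset_rfl)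
    · intro v hv w hw hvw
      rcases hsupp _ _ _ hv with ⟨hv', hv1⟩ | ⟨v', hv', hv1, rfl⟩ <;>
      rcases hsupp _ _ _ hw with ⟨hw', hw1⟩ | ⟨w', hw', hw1, rfl⟩
      · exact hch v hv' w hw' hvw
      -- Unmoved mass at `v` meets mass arriving from `w'` only if `v.1 = 2 * w'.1`. As higher
      -- levels move first, `v.1 ≤ w'.1`, so both levels are `0` and the original flag applies.
      · have hlt : ¬ w'.1 < v.1 := fun h => hv1 (moved_eq_one_of_pos h hw1)
        simp only [d] at hvw
        exact hch v hv' w' hw' (by omega)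
      · have hlt : ¬ v'.1 < w.1 := fun h => hw1 (moved_eq_one_of_pos h hv1)
        simp only [d] at hvw
        exact hch v' hv' w hw' (by omega)
      · simp only [d] at hvw
        exact hch v' hv' w' hw' (by omega)
    · intro v hv
      rcases hsupp _ _ _ hv with ⟨hv', -⟩ | ⟨v', hv', -, rfl⟩
      exacts [hxT v hv', hxT v' hv']
  choose F hF using hex
  refine homotopic_of_continuous (F := F) (continuous_homotopy_of_coord (fun S => ?_) fun s w => ?_)
    (fun x => Subtype.ext ?_) fun x => Subtype.ext ?_
  · refine ⟨S ∪ S.image d, fun x t hx v hv => ?_⟩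
    rw [hF] at hv
    rcases hsupp _ _ _ hv with ⟨hv', -⟩ | ⟨v', hv', -, rfl⟩
    · exact Finset.mem_union_left _ (hx hv')
    · exact Finset.mem_union_right _ (Finset.mem_image_of_mem _ (hx hv'))
  · have e : ∀ p : stdSimplex ℝ (s : Finset (Σ _ : ℕ, V)) × unitInterval,
        (F (simplexMap _ s p.1, p.2)).1 w = raw s.1 (simplexMap _ s p.1).1 p.2 w := fun p => by
      rw [hF, hraw s.1 _ _ (support_simplexMap_subset s p.1)]
    simp only [e, raw, Finsupp.add_apply]
    have hm : ∀ v : Σ _ : ℕ, V, Continuous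
        fun p : stdSimplex ℝ (s : Finset (Σ _ : ℕ, V)) × unitInterval => moved v.1 p.2 :=
      fun v => (continuous_moved v.1).comp (by fun_prop)
    have hs : ∀ v : Σ _ : ℕ, V, Continuous
        fun p : stdSimplex ℝ (s : Finset (Σ _ : ℕ, V)) × unitInterval =>
          (simplexMap (levelComplex C ℕ) s p.1).1 v :=
      fun v => (continuous_simplexMap_apply s v).comp continuous_fst
    exact (continuous_sum_single_apply _ _ (fun v => (continuous_const.sub (hm v)).mul (hs v)) w).add
      (continuous_sum_single_apply _ _ (fun v => (hm v).mul (hs v)) w)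
  · rw [hF]
    simp only [raw, Set.Icc.coe_zero, moved_zero, sub_zero, one_mul, zero_mul, Finsupp.single_zero,
      Finset.sum_const_zero, add_zero]
    exact Finsupp.sum_single x.1
  · rw [hF]
    simp only [raw, Set.Icc.coe_one, moved_one, sub_self, one_mul, zero_mul, Finsupp.single_zero,
      Finset.sum_const_zero, zero_add]
    rfl

/-! ### A homotopy inverse of the projection -/

/-- The point `x` goes to the normalized weighted sum of the vertices `c σ` on levels `2 * σ.card +
1`. At most one `σ` of each cardinality has nonzero weight, so each level carries at most one vertex
and `c` need not respect the order. Odd levels leave the even ones free for the doubled identity. -/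
theorem exists_section (C : AbstractSimplicialComplex V) {c : Finset V → V}
    (hc : ∀ σ : Finset V, σ.Nonempty → c σ ∈ σ) :
    ∃ g : C(Realization C, Realization (levelComplex C ℕ)), FinitelyCarried g ∧
      ∀ x, ∀ v ∈ (g x).1.support, v.2 ∈ x.1.support ∧ ∀ i, v.1 ≠ 2 * i := by
  classical
  let total : Finset V → (V →₀ ℝ) → NNReal := fun S x => ∑ σ ∈ nonemptySubsets S, weight S x σ
  let raw : Finset V → (V →₀ ℝ) → (Σ _ : ℕ, V) →₀ ℝ := fun S x =>
    ∑ σ ∈ nonemptySubsets S,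
      Finsupp.single ⟨2 * σ.card + 1, c σ⟩ ((weight S x σ : ℝ) / (total S x : ℝ))
  have hsub : ∀ {S T : Finset V}, S ⊆ T → nonemptySubsets S ⊆ nonemptySubsets T := fun h =>
    Finset.filter_subset_filter _ (Finset.powerset_mono.2 h)
  have hzero : ∀ {S : Finset V} {x : V →₀ ℝ} {σ}, σ ∈ nonemptySubsets S → σ ∉ nonemptySubsets x.support →
      weight x.support x σ = 0 := fun {S x σ} h1 h2 => by
    by_contra h
    refine h2 (Finset.mem_filter.2 ⟨?_, (Finset.mem_filter.1 h1).2⟩)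
    exact Finset.mem_powerset.2 (subset_support_of_weight_ne_zero h)
  have htotal : ∀ {S : Finset V} {x : V →₀ ℝ}, x.support ⊆ S → total S x = total x.support x := fun {S x} h => by
    simp only [total, weight_eq_weight_support h]
    exact (Finset.sum_subset (hsub h) fun σ h1 h2 => hzero h1 h2).symm
  have hraw : ∀ {S : Finset V} {x : V →₀ ℝ}, x.support ⊆ S → raw S x = raw x.support x := fun {S x} h => by
    simp only [raw, htotal h, weight_eq_weight_support h]
    refine (Finset.sum_subset (hsub h) fun σ h1 h2 => ?_).symm
    rw [hzero h1 h2, NNReal.coe_zero, zero_div, Finsupp.single_zero]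
  have hpos : ∀ x : Realization C, 0 < total x.1.support x.1 := fun x =>
    (weight_support_pos x.nonneg).trans_le (Finset.single_le_sum
      (f := fun σ => weight x.1.support x.1 σ) (fun _ _ => zero_le)
      (Finset.mem_filter.2 ⟨Finset.mem_powerset_self _,
        (C.isRelLowerSet_faces x.support_mem).1⟩))
  have hsupp : ∀ x v, v ∈ (raw x.support x).support →
      ∃ σ ∈ nonemptySubsets x.support, weight x.support x σ ≠ 0 ∧ v = ⟨2 * σ.card + 1, c σ⟩ :=
    fun x v hv => by
      obtain ⟨σ, hσ, hne, rfl⟩ := mem_support_sum_single hv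
      refine ⟨σ, hσ, fun h => hne ?_, rfl⟩
      rw [h, NNReal.coe_zero, zero_div]
  have hmem : ∀ {S σ}, σ ∈ nonemptySubsets S → c σ ∈ S := fun h =>
    Finset.mem_powerset.1 (Finset.mem_filter.1 h).1 (hc _ (Finset.mem_filter.1 h).2)
  have hex : ∀ x : Realization C, ∃ y : Realization (levelComplex C ℕ),
      y.1 = raw x.1.support x.1 := fun x => by
    refine ⟨levelPoint _ (sum_single_nonneg fun σ _ => by positivity) ?_ ?_ x.support_mem ?_, rfl⟩
    · rw [sum_sum_single, ← Finset.sum_div, ← NNReal.coe_sum]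
      exact div_self (NNReal.coe_ne_zero.2 (hpos x).ne')
    · intro v hv w hw hvw
      obtain ⟨σ, -, hσ, rfl⟩ := hsupp _ _ hv
      obtain ⟨τ, -, hτ, rfl⟩ := hsupp _ _ hw
      rw [eq_of_weight_ne_zero hσ hτ (by simpa using hvw)]
      exact Or.inl le_rfl
    · intro v hv
      obtain ⟨σ, hσ, -, rfl⟩ := hsupp _ _ hv
      exact hmem hσ
  choose g hg using hex
  have hfc : FinitelyCarried g := fun S => by
    refine ⟨(nonemptySubsets S).image fun σ => ⟨2 * σ.card + 1, c σ⟩, fun x hx v hv => ?_⟩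
    rw [hg] at hv
    obtain ⟨σ, hσ, -, rfl⟩ := hsupp _ _ hv
    exact Finset.mem_image_of_mem _ (hsub hx hσ)
  refine ⟨⟨g, hfc.continuous_of_coord fun s w => ?_⟩, hfc, fun x v hv => ?_⟩
  · have e : ∀ y, (g (simplexMap C s y)).1 w = raw s.1 (simplexMap C s y).1 w := fun y => by
      rw [hg, hraw (support_simplexMap_subset s y)]
    simp only [e, raw]
    have hw : ∀ σ, Continuous fun y => weight s.1 (simplexMap C s y).1 σ :=
      continuous_weight (continuous_simplexMap_apply s) s.1
    refine continuous_sum_single_apply _ _ (fun σ => ?_) w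
    refine (NNReal.continuous_coe.comp (hw σ)).div
      (NNReal.continuous_coe.comp (continuous_finsetSum _ fun σ _ => hw σ)) fun y => ?_
    have := (hpos (simplexMap C s y)).ne'
    rw [← htotal (support_simplexMap_subset s y)] at this
    exact NNReal.coe_ne_zero.2 this
  · change v ∈ (g x).1.support at hv
    rw [hg] at hv
    obtain ⟨σ, hσ, -, rfl⟩ := hsupp _ _ hv
    exact ⟨hmem hσ, fun i => by dsimp only; omega⟩

/-- The projection of the complex of levels indexed by the natural numbers is a homotopy
equivalence. -/
theorem isHomotopyEquivalence_levelProj [Nonempty V] (C : AbstractSimplicialComplex V) :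
    IsHomotopyEquivalence (realizationMap (levelProj C ℕ)) := by
  classical
  obtain ⟨g, hg, hsupp⟩ := exists_section C (c := fun σ => Classical.epsilon (· ∈ σ))
    fun σ hσ => Classical.epsilon_spec hσ
  have hproj : FinitelyCarried (realizationMap (levelProj C ℕ)) := finitelyCarried_realizationFun _
  refine ⟨g, ?_, ?_⟩
  -- The doubled point and its image under `g` after projection lie over the same simplex `T`. They
  -- occupy levels of different parity, so the union of their supports is again a simplex.
  · refine ContinuousMap.Homotopic.symm ((homotopic_double C).trans ?_)
    refine homotopic_of_contiguous _ _ (finitelyCarried_realizationFun _)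
      (hg.comp hproj) fun x => ?_
    obtain ⟨hne, hch, T, hT, hxT⟩ := x.support_mem
    have h1 : ∀ v ∈ (realizationMap (levelReindex C doubleEmb) x).1.support,
        ∃ w ∈ x.1.support, v = ⟨2 * w.1, w.2⟩ := fun v hv => by
      obtain ⟨w, hw, rfl⟩ := Finset.mem_image.1 (support_realizationFun_subset _ x hv)
      exact ⟨w, hw, rfl⟩
    have h2 : ∀ v ∈ (g (realizationMap (levelProj C ℕ) x)).1.support,
        v.2 ∈ T ∧ ∀ i, v.1 ≠ 2 * i := fun v hv => by
      obtain ⟨hv, hi⟩ := hsupp _ v hv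
      obtain ⟨w, hw, hwv⟩ := Finset.mem_image.1 (support_realizationFun_subset _ x hv)
      exact ⟨hwv ▸ hxT w hw, hi⟩
    obtain ⟨hgne, hgch, -⟩ := (g (realizationMap (levelProj C ℕ) x)).support_mem
    refine ⟨_, ⟨hgne.mono Finset.subset_union_right, fun v hv w hw hvw => ?_, T, hT, fun v hv => ?_⟩,
      Finset.subset_union_left, Finset.subset_union_right⟩
    · rcases Finset.mem_union.1 hv with hv | hv <;> rcases Finset.mem_union.1 hw with hw | hw
      · obtain ⟨v', hv', rfl⟩ := h1 v hv
        obtain ⟨w', hw', rfl⟩ := h1 w hw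
        exact hch v' hv' w' hw' (by simpa using hvw)
      · obtain ⟨v', -, rfl⟩ := h1 v hv
        exact absurd hvw.symm ((h2 w hw).2 _)
      · obtain ⟨w', -, rfl⟩ := h1 w hw
        exact absurd hvw ((h2 v hv).2 _)
      · exact hgch v hv w hw hvw
    · rcases Finset.mem_union.1 hv with hv | hv
      · obtain ⟨v', hv', rfl⟩ := h1 v hv
        exact hxT v' hv'
      · exact (h2 v hv).1
  · refine homotopic_of_contiguous _ _ (hproj.comp hg) FinitelyCarried.id fun x =>
      ⟨_, x.support_mem, fun v hv => ?_, subset_rfl⟩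
    obtain ⟨w, hw, rfl⟩ := Finset.mem_image.1 (support_realizationFun_subset _ (g x) hv)
    exact (hsupp x w hw).1

end Levels

/-! ### The colimit of the higher Tits buildings -/

theorem exists_forall_level_lt {V : Type*} (s : Finset (Σ _ : ℕ, V)) : ∃ k, ∀ v ∈ s, v.1 < k :=
  ⟨s.sup Sigma.fst + 1, fun _ hv => Nat.lt_succ_of_le (Finset.le_sup (f := Sigma.fst) hv)⟩

section Stable

variable (R : Type u) [CommRing R] [IsDomain R] [IsPrincipalIdealRing R] (n : ℕ)

/-- The union of the higher Tits buildings `T^k_n(R)`. -/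
abbrev stableBuilding : AbstractSimplicialComplex (Σ _ : ℕ, Summand R n) :=
  levelComplex (commonBasisComplex R n) ℕ

variable {R n}

/-- The underlying set of summands serves as the simplex of `CB_n(R)`; conversely, a common basis
passes to subcollections. -/
theorem mem_higherBuilding_faces_iff {k : ℕ} {s : Finset (Σ _ : Fin k, Summand R n)} :
    s ∈ (higherBuilding R n k).faces ↔
      s ∈ (levelComplex (commonBasisComplex R n) (Fin k)).faces := by
  classical
  constructor
  · rintro ⟨⟨hne, hch⟩, hb⟩
    refine ⟨hne, ?_, s.image fun v => v.2, ⟨hne.image _, ?_⟩,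
      fun v hv => Finset.mem_image_of_mem _ hv⟩
    · rintro ⟨i, v⟩ hv ⟨j, w⟩ hw (rfl : i = j)
      have hv' : v ∈ joinPart s i := by simpa [joinPart] using hv
      have hw' : w ∈ joinPart s i := by simpa [joinPart] using hw
      exact (hch i ⟨v, hv'⟩).2.total hv' hw'
    · rwa [Finset.coe_image, Set.image_image]
  · rintro ⟨hne, hch, t, ht, hst⟩
    refine ⟨⟨hne, fun i hi => ⟨hi, fun v hv w hw _ => ?_⟩⟩, ht.2.mono ?_⟩
    · have hv' : ⟨i, v⟩ ∈ s := by simpa [joinPart] using hv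
      have hw' : ⟨i, w⟩ ∈ s := by simpa [joinPart] using hw
      exact hch _ hv' _ hw' rfl
    · rintro _ ⟨v, hv, rfl⟩
      exact ⟨v.2, hst v hv, rfl⟩

variable (R n) in
/-- The inclusion of a higher Tits building into the union of all of them. -/
def stableInclusion (k : ℕ) : SimplicialMap (higherBuilding R n k) (stableBuilding R n) where
  toFun v := ⟨v.1, v.2⟩
  map_face s hs := (levelReindex (commonBasisComplex R n) Fin.valEmbedding).map_face s
    (mem_higherBuilding_faces_iff.1 hs)

theorem stableInclusion_injective (k : ℕ) : Function.Injective (stableInclusion R n k).toFun := by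
  rintro ⟨i, v⟩ ⟨j, w⟩ h
  simp only [stableInclusion, Sigma.mk.inj_iff, Fin.val_inj, heq_eq_eq] at h
  obtain ⟨rfl, rfl⟩ := h
  rfl

theorem realizationMap_stableInclusion_injective (k : ℕ) :
    Function.Injective (realizationMap (stableInclusion R n k)) := fun _ _ h =>
  Subtype.ext (Finsupp.mapDomain_injective (stableInclusion_injective k) (congrArg Subtype.val h))

theorem stableInclusion_levelMap {k j : ℕ} (h : k ≤ j) (y : Realization (higherBuilding R n k)) :
    realizationMap (stableInclusion R n j) (realizationMap (levelMap R n (Fin.castLEEmb h)) y) =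
      realizationMap (stableInclusion R n k) y :=
  Subtype.ext (Finsupp.mapDomain_comp (v := y.1)).symm

theorem exists_stableInclusion_eq (k : ℕ) (x : Realization (stableBuilding R n))
    (hx : ∀ v ∈ x.1.support, v.1 < k) : ∃ y, realizationMap (stableInclusion R n k) y = x := by
  classical
  let e := (stableInclusion R n k).toFun
  let y := x.1.comapDomain e (stableInclusion_injective k).injOn
  have hy : y.mapDomain e = x.1 := by
    refine Finsupp.mapDomain_comapDomain _ (stableInclusion_injective k) _ fun v hv => ?_
    exact ⟨⟨⟨v.1, hx v hv⟩, v.2⟩, rfl⟩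
  have hsum : (y.sum fun _ a => a) = 1 := by
    rw [← Finsupp.sum_mapDomain_index (f := e) (h := fun _ a => a) (by simp) (by simp), hy]
    exact x.2.2.1
  refine ⟨⟨y, fun v => x.nonneg _, hsum, mem_higherBuilding_faces_iff.2 ?_⟩, Subtype.ext hy⟩
  obtain ⟨-, hch, t, ht, hxt⟩ := x.support_mem
  have hmem : ∀ v ∈ y.support, e v ∈ x.1.support := fun v hv => by
    rwa [Finsupp.mem_support_iff] at hv ⊢
  refine ⟨?_, fun v hv w hw hvw => ?_, t, ht, fun v hv => hxt _ (hmem v hv)⟩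
  · rw [Finset.nonempty_iff_ne_empty]
    intro h
    rw [Finsupp.support_eq_empty.1 h] at hsum
    simp at hsum
  · exact hch _ (hmem v hv) _ (hmem w hw) (congrArg Fin.val hvw)

/-- The union of the higher Tits buildings has the universal property of their colimit. -/
theorem exists_stable_desc {Z : Type*} [TopologicalSpace Z]
    (φ : ∀ k, C(Realization (higherBuilding R n k), Z))
    (hφ : ∀ (k j : ℕ) (h : k ≤ j) (y : Realization (higherBuilding R n k)),
      φ j (realizationMap (levelMap R n (Fin.castLEEmb h)) y) = φ k y) :
    ∃ f : C(Realization (stableBuilding R n), Z),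
      ∀ k y, f (realizationMap (stableInclusion R n k) y) = φ k y := by
  classical
  -- Two lifts of one point agree at the later stage, because the inclusion of that stage is
  -- injective.
  have hwd : ∀ {k j : ℕ} {y : Realization (higherBuilding R n k)}
      {z : Realization (higherBuilding R n j)}, k ≤ j →
      realizationMap (stableInclusion R n k) y = realizationMap (stableInclusion R n j) z →
      φ k y = φ j z := fun {k j y z} h hyz => by
    rw [← stableInclusion_levelMap h] at hyz
    rw [← hφ k j h, realizationMap_stableInclusion_injective j hyz]
  have hex : ∀ x : Realization (stableBuilding R n), ∃ (k : ℕ) (y : _),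
      realizationMap (stableInclusion R n k) y = x := fun x =>
    (exists_forall_level_lt x.1.support).imp fun k hk => exists_stableInclusion_eq k x hk
  choose K Y hY using hex
  have hf : ∀ k y, φ _ (Y (realizationMap (stableInclusion R n k) y)) = φ k y := fun k y =>
    (le_total k (K (realizationMap (stableInclusion R n k) y))).elim
      (fun h => (hwd h (hY _).symm).symm) fun h => hwd h (hY _)
  refine ⟨⟨fun x => φ _ (Y x), continuous_realization_iff.2 fun s => ?_⟩, hf⟩
  -- A closed simplex involves finitely many levels, so it lifts to a single stage. The lift only
  -- relabels coordinates, hence is continuous.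
  obtain ⟨k, hk⟩ := exists_forall_level_lt s.1
  choose r hr using fun y => exists_stableInclusion_eq k (simplexMap _ s y)
    fun v hv => hk v (support_simplexMap_subset s y hv)
  have hcoord : ∀ y w, (r y).1 w = (simplexMap _ s y).1 ((stableInclusion R n k).toFun w) :=
    fun y w => by
      rw [← hr y]
      exact (Finsupp.mapDomain_apply (stableInclusion_injective k) _ _).symm
  have hrc : Continuous r := by
    refine continuous_of_coord (s.1.preimage _ (stableInclusion_injective k).injOn)
      (fun y w hw => ?_) fun w => ?_
    · rw [Finsupp.mem_support_iff, hcoord] at hw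
      exact Finset.mem_preimage.2
        (support_simplexMap_subset s y (Finsupp.mem_support_iff.2 hw))
    · simp only [hcoord]
      exact continuous_simplexMap_apply s _
  exact ((φ k).continuous.comp hrc).congr fun y =>
    (hf k (r y)).symm.trans (congrArg (fun x => φ _ (Y x)) (hr y))

variable (R n) in
/-- The inclusions of the higher Tits buildings into their union. -/
def stableCocone : Cocone (buildingTower R n) where
  pt := TopCat.of (Realization (stableBuilding R n))
  ι :=
    { app := fun k => TopCat.ofHom (realizationMap (stableInclusion R n k))
      naturality := fun _ _ f => by
        ext x
        exact stableInclusion_levelMap (leOfHom f) x }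

variable (R n) in
/-- The canonical map from the colimit to the union. -/
def colimitToStable :
    C(↑(colimit (buildingTower R n)), Realization (stableBuilding R n)) :=
  (colimit.desc (buildingTower R n) (stableCocone R n)).hom

theorem colimitToStable_ι (k : ℕ) (y : Realization (higherBuilding R n k)) :
    colimitToStable R n ((colimit.ι (buildingTower R n) k).hom y) =
      realizationMap (stableInclusion R n k) y :=
  ConcreteCategory.congr_hom (colimit.ι_desc (stableCocone R n) k) y

/-- The two universal properties give maps both ways. The composites are identities because this
holds on the image of each finite stage, and these images determine maps out of the colimit and
cover the union. -/
theorem exists_stableToColimit :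
    ∃ E : C(Realization (stableBuilding R n), ↑(colimit (buildingTower R n))),
      E.comp (colimitToStable R n) = ContinuousMap.id _ ∧
        (colimitToStable R n).comp E = ContinuousMap.id _ := by
  obtain ⟨E, hE⟩ := exists_stable_desc (R := R) (n := n)
    (fun k => (colimit.ι (buildingTower R n) k).hom) fun k j h y =>
      ConcreteCategory.congr_hom (colimit.w (buildingTower R n) (homOfLE h)) y
  refine ⟨E, ?_, ?_⟩
  · have : colimit.desc (buildingTower R n) (stableCocone R n) ≫ TopCat.ofHom E = 𝟙 _ := by
      refine colimit.hom_ext fun k => ?_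
      ext y
      exact (congrArg E (colimitToStable_ι k y)).trans (hE k y)
    exact congrArg TopCat.Hom.hom this
  · ext1 x
    obtain ⟨k, hk⟩ := exists_forall_level_lt x.1.support
    obtain ⟨y, rfl⟩ := exists_stableInclusion_eq k x hk
    exact (congrArg _ (hE k y)).trans (colimitToStable_ι k y)

theorem colimUnionMap_eq :
    (colimUnionMap R n).hom =
      (realizationMap (levelProj (commonBasisComplex R n) ℕ)).comp (colimitToStable R n) := by
  have : colimUnionMap R n = colimit.desc (buildingTower R n) (stableCocone R n) ≫
      TopCat.ofHom (realizationMap (levelProj (commonBasisComplex R n) ℕ)) := by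
    refine colimit.hom_ext fun k => ?_
    ext y
    refine (ConcreteCategory.congr_hom (colimit.ι_desc (unionCocone R n) k) y).trans ?_
    refine Eq.trans ?_ (congrArg (realizationMap (levelProj (commonBasisComplex R n) ℕ))
      (colimitToStable_ι k y)).symm
    exact Subtype.ext (Finsupp.mapDomain_comp (v := y.1) (f := (stableInclusion R n k).toFun)
      (g := (levelProj (commonBasisComplex R n) ℕ).toFun))
  exact congrArg TopCat.Hom.hom this

end Stable

/-! ### Composition with homeomorphisms, and empty spaces -/

theorem isHomotopyEquivalence_comp_of_inverse {X Y Z : Type u} [TopologicalSpace X]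
    [TopologicalSpace Y] [TopologicalSpace Z] {f : C(Y, Z)} (hf : IsHomotopyEquivalence f)
    {q : C(X, Y)} {e : C(Y, X)} (heq : e.comp q = ContinuousMap.id X)
    (hqe : q.comp e = ContinuousMap.id Y) : IsHomotopyEquivalence (f.comp q) := by
  obtain ⟨g, hg, hg'⟩ := hf
  refine ⟨e.comp g, ?_, ?_⟩
  · have h := (ContinuousMap.Homotopic.refl e).comp (hg.comp (ContinuousMap.Homotopic.refl q))
    rwa [ContinuousMap.id_comp, heq] at h
  · rwa [ContinuousMap.comp_assoc, ← ContinuousMap.comp_assoc q, hqe, ContinuousMap.id_comp]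

theorem isHomotopyEquivalence_of_isEmpty {X Y : Type u} [TopologicalSpace X] [TopologicalSpace Y]
    [IsEmpty X] [IsEmpty Y] (f : C(X, Y)) : IsHomotopyEquivalence f := by
  let g : C(Y, X) := ⟨fun y => isEmptyElim y, continuous_of_const fun y => isEmptyElim y⟩
  have h1 : g.comp f = ContinuousMap.id X := ContinuousMap.ext fun x => isEmptyElim x
  have h2 : f.comp g = ContinuousMap.id Y := ContinuousMap.ext fun y => isEmptyElim y
  exact ⟨g, h1 ▸ ContinuousMap.Homotopic.refl _, h2 ▸ ContinuousMap.Homotopic.refl _⟩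

theorem Realization.isEmpty {V : Type u} [IsEmpty V] (K : AbstractSimplicialComplex V) :
    IsEmpty (Realization K) :=
  ⟨fun x => by
    obtain ⟨v, -⟩ := (K.isRelLowerSet_faces x.support_mem).1
    exact isEmptyElim v⟩

end CommonBasis

end

theorem mainTheorem9 (R : Type u) [CommRing R] [IsDomain R] [IsPrincipalIdealRing R] (n : ℕ) :
    CommonBasis.IsHomotopyEquivalence (CommonBasis.colimUnionMap R n).hom := by
  obtain ⟨E, h1, h2⟩ := CommonBasis.exists_stableToColimit (R := R) (n := n)
  rw [CommonBasis.colimUnionMap_eq]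
  refine CommonBasis.isHomotopyEquivalence_comp_of_inverse ?_ h1 h2
  -- Choosing a vertex from each set requires some vertex to exist; without vertices, as for `n =
  -- 0`, both realizations are empty.
  rcases isEmpty_or_nonempty (CommonBasis.Summand R n) with h | h
  · have : IsEmpty (Σ _ : ℕ, CommonBasis.Summand R n) := ⟨fun v => h.false v.2⟩
    have := CommonBasis.Realization.isEmpty (CommonBasis.stableBuilding R n)
    have := CommonBasis.Realization.isEmpty (CommonBasis.commonBasisComplex R n)
    exact CommonBasis.isHomotopyEquivalence_of_isEmpty _
  · exact CommonBasis.isHomotopyEquivalence_levelProj _
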